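/- Let $N\ge 2$. For an integer $K\ge 1$ let $C(S^{N-1}_{\mathbb C,K})$ (the algebra of the $K$-half-liberated complex sphere) be the universal unital $C^*$-algebra generated by elements $z_1,\dots,z_N$ subject to the relations $$\sum_{i=1}^N z_iz_i^*=1=\sum_{i=1}^N z_i^*z_i,\qquad [z_{i_1}\cdots z_{i_K},\,z_{j_1}\cdots z_{j_K}]=0=[z_{i_1}\cdots z_{i_K},\,z_{j_1}^*\cdots z_{j_K}^*]$$ for all $i_1,\dots,i_K,j_1,\dots,j_K\in\{1,\dots,N\}$, that is, the completion of the $*$-algebra of noncommutative polynomials in $z_i,z_i^*$ with respect to the biggest $C^*$-seminorm that vanishes on these relations. Representations are unital $*$-representations by bounded operators on complex Hilbert spaces; a representation on $H$ is irreducible if $H\neq 0$ and the only closed invariant subspaces are $0$ and $H$. Then, for every $K\ge 1$: 1. $C(S^{N-1}_{\mathbb C,K})$ has an irreducible representation of dimension $K$. 2. Every irreducible representation of $C(S^{N-1}_{\mathbb C,K})$ is finite dimensional, of dimension $\le K$. In particular, for $K,K'\ge 1$ with $K\neq K'$, the $C^*$-algebras $C(S^{N-1}_{\mathbb C,K})$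 and $C(S^{N-1}_{\mathbb C,K'})$ are not isomorphic. -/

import Mathlib

noncomputable section

open scoped ComplexConjugate

/-! ### Noncommutative `*`-polynomials -/

/-- Words in the letters `(i, true)`, read as `zᵢ`, and `(i, false)`, read as `zᵢ*`. -/
abbrev StarWord (N : ℕ) : Type := FreeMonoid (Fin N × Bool)

/-- The adjoint of a word: reverse it and exchange `zᵢ` and `zᵢ*` in each letter. -/
def StarWord.adj {N : ℕ} (w : StarWord N) : StarWord N :=
  FreeMonoid.ofList ((w.toList.map fun l => (l.1, !l.2)).reverse)

lemma StarWord.adj_mul {N : ℕ} (v w : StarWord N) : (v * w).adj = w.adj * v.adj := by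
  simp [StarWord.adj]

lemma StarWord.adj_adj {N : ℕ} (w : StarWord N) : w.adj.adj = w := by
  simp [StarWord.adj, List.map_reverse, Function.comp_def]

/-- The free unital complex algebra `ℂ⟨z₁, …, z_N, z₁*, …, z_N*⟩`: finite complex linear
combinations of words, multiplied by concatenation. -/
def StarPoly (N : ℕ) : Type := MonoidAlgebra ℂ (StarWord N)

namespace StarPoly

variable {N : ℕ}

instance : Ring (StarPoly N) := inferInstanceAs (Ring (MonoidAlgebra ℂ (StarWord N)))

instance : Algebra ℂ (StarPoly N) := inferInstanceAs (Algebra ℂ (MonoidAlgebra ℂ (StarWord N)))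

/-- The monomial `c w`. -/
def monomial (w : StarWord N) (c : ℂ) : StarPoly N := MonoidAlgebra.single w c

/-- The conjugate-linear antimultiplicative involution, `∑ c_w w ↦ ∑ conj(c_w) w*`. -/
def adj (f : StarPoly N) : StarPoly N :=
  MonoidAlgebra.ofCoeff
    ((Finsupp.mapRange conj (map_zero conj) (MonoidAlgebra.coeff f)).mapDomain StarWord.adj)

lemma adj_monomial (w : StarWord N) (c : ℂ) : adj (monomial w c) = monomial w.adj (conj c) := by
  simp only [adj, monomial, MonoidAlgebra.coeff_single, Finsupp.mapRange_single,
    Finsupp.mapDomain_single]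
  rfl

lemma adj_add (f g : StarPoly N) : adj (f + g) = adj f + adj g := by
  have h : MonoidAlgebra.coeff (f + g) = MonoidAlgebra.coeff f + MonoidAlgebra.coeff g := rfl
  simp only [adj, h, Finsupp.mapRange_add (map_add conj), Finsupp.mapDomain_add]
  rfl

lemma adj_zero : adj (0 : StarPoly N) = 0 := by
  have h : MonoidAlgebra.coeff (0 : StarPoly N) = 0 := rfl
  simp only [adj, h, Finsupp.mapRange_zero, Finsupp.mapDomain_zero]
  rfl

lemma induction_monomial {motive : StarPoly N → Prop} (f : StarPoly N) (zero : motive 0)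
    (add : ∀ f g, motive f → motive g → motive (f + g))
    (mono : ∀ w c, motive (monomial w c)) : motive f :=
  MonoidAlgebra.induction_linear f zero add mono

lemma monomial_mul (v w : StarWord N) (c d : ℂ) :
    monomial v c * monomial w d = monomial (v * w) (c * d) :=
  MonoidAlgebra.single_mul_single ..

lemma smul_monomial (w : StarWord N) (c d : ℂ) : c • monomial w d = monomial w (c * d) :=
  MonoidAlgebra.smul_single ..

instance : StarRing (StarPoly N) where
  star := adj
  star_involutive f := by
    induction f using induction_monomial with
    | zero => simp only [adj_zero]
    | add f g hf hg => simp only [adj_add, hf, hg]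
    | mono w c => simp [adj_monomial, StarWord.adj_adj]
  star_mul f g := by
    show adj (f * g) = adj g * adj f
    induction f using induction_monomial with
    | zero => simp [adj_zero]
    | add f f' hf hf' => simp only [add_mul, mul_add, adj_add, hf, hf']
    | mono v c =>
      induction g using induction_monomial with
      | zero => simp [adj_zero]
      | add g g' hg hg' => simp only [add_mul, mul_add, adj_add, hg, hg']
      | mono w d =>
        simp only [adj_monomial, monomial_mul, StarWord.adj_mul, map_mul, mul_comm]
  star_add := adj_add

instance : StarModule ℂ (StarPoly N) where
  star_smul c f := by
    show adj (c • f) = conj c • adj f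
    induction f using induction_monomial with
    | zero => simp [adj_zero]
    | add f g hf hg => simp only [smul_add, adj_add, hf, hg]
    | mono w d => simp only [smul_monomial, adj_monomial, map_mul]

/-- The coordinate `zᵢ`; its adjoint `star (z i)` is the letter `zᵢ*`. -/
def z (i : Fin N) : StarPoly N := monomial (FreeMonoid.of (i, true)) 1

lemma star_z (i : Fin N) : star (z i) = monomial (FreeMonoid.of (i, false)) 1 := by
  show adj (z i) = _
  rw [z, adj_monomial, map_one]
  rfl

end StarPoly

/-! ### `C*`-seminorms and the associated completions -/

/-- A `C*`-seminorm on a complex `*`-algebra: a submultiplicative seminorm `p` such that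
`p (x* x) = p(x)²`. -/
structure CStarSeminorm (P : Type*) [Ring P] [StarRing P] [Algebra ℂ P] extends
    Seminorm ℂ P where
  mul_le' : ∀ x y, toFun (x * y) ≤ toFun x * toFun y
  star_mul_self' : ∀ x, toFun (star x * x) = toFun x ^ 2

namespace CStarSeminorm

variable {P : Type*} [Ring P] [StarRing P] [Algebra ℂ P]

instance : CoeFun (CStarSeminorm P) fun _ => P → ℝ := ⟨fun p => p.toSeminorm⟩

lemma mul_le (p : CStarSeminorm P) (x y : P) : p (x * y) ≤ p x * p y := p.mul_le' x y

lemma star_mul_self (p : CStarSeminorm P) (x : P) : p (star x * x) = p x ^ 2 :=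
  p.star_mul_self' x

lemma nonneg (p : CStarSeminorm P) (x : P) : 0 ≤ p x := apply_nonneg p.toSeminorm x

lemma map_one_le (p : CStarSeminorm P) : p 1 ≤ 1 := by
  have h := p.star_mul_self 1
  rw [star_one, one_mul] at h
  nlinarith [p.nonneg 1]

lemma le_star (p : CStarSeminorm P) (x : P) : p x ≤ p (star x) := by
  have h := p.mul_le (star x) x
  rw [star_mul_self] at h
  by_contra! hlt
  nlinarith [p.nonneg x, p.nonneg (star x)]

lemma map_star (p : CStarSeminorm P) (x : P) : p (star x) = p x :=
  le_antisymm (by simpa using p.le_star (star x)) (p.le_star x)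

/-- The `*`-algebra `P`, equipped with the seminorm `p`. -/
@[nolint unusedArguments]
def Pre (_p : CStarSeminorm P) : Type _ := P

variable (p : CStarSeminorm P)

instance : Ring p.Pre := inferInstanceAs (Ring P)

instance : StarRing p.Pre := inferInstanceAs (StarRing P)

instance : Algebra ℂ p.Pre := inferInstanceAs (Algebra ℂ P)

instance [StarModule ℂ P] : StarModule ℂ p.Pre := inferInstanceAs (StarModule ℂ P)

instance : SeminormedRing p.Pre :=
  { (inferInstance : Ring p.Pre),
    p.toSeminorm.toAddGroupSeminorm.toSeminormedAddCommGroup with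
    norm_mul_le := p.mul_le }

lemma norm_pre (x : p.Pre) : ‖x‖ = p x := rfl

instance : NormedAlgebra ℂ p.Pre where
  norm_smul_le c x := (map_smul_eq_mul p.toSeminorm c x).le

instance : NormedStarGroup p.Pre where
  norm_star_le x := (p.map_star x).le

/-- The Hausdorff completion of `P` with respect to `p`. -/
def Compl : Type _ := UniformSpace.Completion p.Pre

namespace Compl

open UniformSpace

instance : NormedRing p.Compl := inferInstanceAs (NormedRing (Completion p.Pre))

instance : CompleteSpace p.Compl := inferInstanceAs (CompleteSpace (Completion p.Pre))

instance : Algebra ℂ p.Compl := inferInstanceAs (Algebra ℂ (Completion p.Pre))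

instance : NormedAlgebra ℂ p.Compl where
  norm_smul_le c x := norm_smul_le (β := Completion p.Pre) c x

/-- The canonical map from `P` to the completion. -/
def of (x : P) : p.Compl := ((show p.Pre from x : p.Pre) : Completion p.Pre)

lemma norm_of (x : P) : ‖of p x‖ = p x := Completion.norm_coe (E := p.Pre) x

lemma of_add (x y : P) : of p (x + y) = of p x + of p y := Completion.coe_add (α := p.Pre) x y

lemma of_mul (x y : P) : of p (x * y) = of p x * of p y := Completion.coe_mul (α := p.Pre) x y

lemma of_one : of p 1 = 1 := rfl

lemma of_smul (c : ℂ) (x : P) : of p (c • x) = c • of p x := Completion.coe_smul (X := p.Pre) c x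

lemma denseRange_of : DenseRange (of p) := Completion.denseRange_coe (α := p.Pre)

/-- The involution of the completion, the continuous extension of that of `P`. -/
instance : Star p.Compl := ⟨Completion.map (star : p.Pre → p.Pre)⟩

lemma star_of (x : P) : star (of p x) = of p (star x) :=
  Completion.map_coe (α := p.Pre) (starNormedAddGroupHom (E := p.Pre)).uniformContinuous x

lemma continuous_star : Continuous (star : p.Compl → p.Compl) :=
  Completion.continuous_map (α := p.Pre)

lemma induction_of {motive : p.Compl → Prop} (x : p.Compl) (hc : IsClosed {x | motive x})
    (h : ∀ x, motive (of p x)) : motive x :=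
  isClosed_property (denseRange_of p) hc h x

instance : StarRing p.Compl where
  star_involutive x := by
    induction x using induction_of with
    | hc => exact isClosed_eq ((continuous_star p).comp (continuous_star p)) continuous_id
    | h x => rw [star_of, star_of, star_star]
  star_mul x y := by
    have hs := continuous_star p
    induction x using induction_of with
    | hc => exact isClosed_eq (by fun_prop) (by fun_prop)
    | h x =>
      induction y using induction_of with
      | hc => exact isClosed_eq (by fun_prop) (by fun_prop)
      | h y => simp only [star_of, ← of_mul, star_mul]
  star_add x y := by
    have hs := continuous_star p
    induction x using induction_of with
    | hc => exact isClosed_eq (by fun_prop) (by fun_prop)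
    | h x =>
      induction y using induction_of with
      | hc => exact isClosed_eq (by fun_prop) (by fun_prop)
      | h y => simp only [star_of, ← of_add, star_add]

instance : CStarRing p.Compl where
  norm_mul_self_le x := by
    have hs := continuous_star p
    induction x using induction_of with
    | hc => exact isClosed_le (by fun_prop) (by fun_prop)
    | h x => rw [star_of, ← of_mul, norm_of, norm_of, star_mul_self, sq]

instance [StarModule ℂ P] : StarModule ℂ p.Compl where
  star_smul c x := by
    induction x using induction_of with
    | hc =>
      exact isClosed_eq ((continuous_star p).comp (continuous_const_smul c))
        ((continuous_star p).const_smul (star c))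
    | h x =>
      rw [star_of, ← of_smul, ← of_smul, star_of]
      exact congrArg (of p) (star_smul c x)

/-- The completion of a `*`-algebra with respect to a `C*`-seminorm is a `C*`-algebra. -/
instance [StarModule ℂ P] : CStarAlgebra p.Compl where

/-- The canonical map as a morphism of `*`-algebras. -/
def ofHom [StarModule ℂ P] : P →⋆ₐ[ℂ] p.Compl where
  toFun := of p
  map_one' := of_one p
  map_mul' := of_mul p
  map_zero' := Completion.coe_zero (α := p.Pre)
  map_add' := of_add p
  commutes' c := by
    rw [Algebra.algebraMap_eq_smul_one, of_smul, of_one, Algebra.algebraMap_eq_smul_one]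
  map_star' x := (star_of p x).symm

end Compl

end CStarSeminorm

/-! ### Algebraic noncommutative submanifolds of the free complex sphere -/

namespace FreeSphere

open StarPoly

variable {N : ℕ}

/-- The relators of the free complex sphere: `∑ zᵢ zᵢ* - 1` and `∑ zᵢ* zᵢ - 1`. -/
def sphereRelators (N : ℕ) : Set (StarPoly N) :=
  {∑ i, z i * star (z i) - 1, ∑ i, star (z i) * z i - 1}

/-- The `C*`-seminorms on `ℂ⟨zᵢ, zᵢ*⟩` which vanish on the sphere relators and on `R`. -/
def Admissible (R : Set (StarPoly N)) : Type :=
  {p : CStarSeminorm (StarPoly N) // ∀ r ∈ sphereRelators N ∪ R, p r = 0}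

/-- The zero seminorm. -/
def zeroAdmissible (R : Set (StarPoly N)) : Admissible R :=
  ⟨{ toSeminorm := 0
     mul_le' := fun _ _ => by change (0 : ℝ) ≤ 0 * 0; simp
     star_mul_self' := fun _ => by change (0 : ℝ) = 0 ^ 2; simp }, fun _ _ => rfl⟩

instance (R : Set (StarPoly N)) : Nonempty (Admissible R) := ⟨zeroAdmissible R⟩

lemma seminorm_z_le_one {R : Set (StarPoly N)} (p : Admissible R) (i : Fin N) :
    p.1 (z i) ≤ 1 := by
  let A := p.1.Compl
  let φ : StarPoly N →⋆ₐ[ℂ] A := CStarSeminorm.Compl.ofHom p.1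
  have hφ : ∀ x, ‖φ x‖ = p.1 x := CStarSeminorm.Compl.norm_of p.1
  let _ : PartialOrder A := CStarAlgebra.spectralOrder A
  have _ : StarOrderedRing A := CStarAlgebra.spectralOrderedRing A
  have hsum : ∑ j, star (φ (z j)) * φ (z j) = 1 := by
    have h0 : φ (∑ j, star (z j) * z j - 1) = 0 := by
      rw [← norm_eq_zero, hφ]
      exact p.2 _ (Or.inl (Or.inr rfl))
    rw [map_sub, map_one, sub_eq_zero, map_sum] at h0
    simpa only [map_mul, map_star] using h0
  have hle : star (φ (z i)) * φ (z i) ≤ 1 := by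
    rw [← hsum]
    exact Finset.single_le_sum (f := fun j => star (φ (z j)) * φ (z j))
      (fun j _ => star_mul_self_nonneg _) (Finset.mem_univ i)
  have h1 := (CStarAlgebra.norm_le_one_iff_of_nonneg _ (star_mul_self_nonneg (φ (z i)))).2 hle
  rw [CStarRing.norm_star_mul_self, hφ] at h1
  nlinarith [p.1.nonneg (z i)]

lemma seminorm_monomial_le {R : Set (StarPoly N)} (p : Admissible R) (w : StarWord N) :
    p.1 (monomial w 1) ≤ 1 := by
  induction w using FreeMonoid.inductionOn' with
  | one => exact p.1.map_one_le
  | of_mul l w ih =>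
    have hl : p.1 (monomial (FreeMonoid.of l) 1) ≤ 1 := by
      obtain ⟨i, _ | _⟩ := l
      · rw [← star_z, p.1.map_star]
        exact seminorm_z_le_one p i
      · exact seminorm_z_le_one p i
    have h : (monomial (FreeMonoid.of l * w) 1 : StarPoly N)
        = monomial (FreeMonoid.of l) 1 * monomial w 1 := by
      rw [monomial_mul, one_mul]
    rw [h]
    exact (p.1.mul_le _ _).trans (mul_le_one₀ hl (p.1.nonneg _) ih)

/-- The admissible `C*`-seminorms are uniformly bounded at every polynomial. -/
lemma bddAbove_seminorms (R : Set (StarPoly N)) (x : StarPoly N) :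
    BddAbove (Set.range fun p : Admissible R => p.1 x) := by
  suffices h : ∃ C : ℝ, ∀ p : Admissible R, p.1 x ≤ C by
    obtain ⟨C, hC⟩ := h
    exact ⟨C, by rintro _ ⟨p, rfl⟩; exact hC p⟩
  induction x using induction_monomial with
  | zero => exact ⟨0, fun p => (map_zero p.1.toSeminorm).le⟩
  | add f g hf hg =>
    obtain ⟨C, hC⟩ := hf
    obtain ⟨D, hD⟩ := hg
    exact ⟨C + D, fun p => (map_add_le_add p.1.toSeminorm f g).trans (add_le_add (hC p) (hD p))⟩
  | mono w c =>
    refine ⟨‖c‖, fun p => ?_⟩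
    have h : (monomial w c : StarPoly N) = c • monomial w 1 := by rw [smul_monomial, mul_one]
    rw [h, map_smul_eq_mul]
    exact mul_le_of_le_one_right (norm_nonneg c) (seminorm_monomial_le p w)

/-- The biggest `C*`-seminorm on `ℂ⟨zᵢ, zᵢ*⟩` which vanishes on the sphere relators and on `R`. -/
def maxSeminorm (R : Set (StarPoly N)) : CStarSeminorm (StarPoly N) where
  toFun x := ⨆ p : Admissible R, p.1 x
  map_zero' := by simp
  add_le' x y := ciSup_le fun p => (map_add_le_add p.1.toSeminorm x y).trans
    (add_le_add (le_ciSup (bddAbove_seminorms R x) p) (le_ciSup (bddAbove_seminorms R y) p))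
  neg' x := by simp
  smul' c x := by
    simp only [map_smul_eq_mul]
    exact (Real.mul_iSup_of_nonneg (norm_nonneg c) _).symm
  mul_le' x y := ciSup_le fun p => (p.1.mul_le x y).trans
    (mul_le_mul (le_ciSup (bddAbove_seminorms R x) p) (le_ciSup (bddAbove_seminorms R y) p)
      (p.1.nonneg y) ((p.1.nonneg x).trans (le_ciSup (bddAbove_seminorms R x) p)))
  star_mul_self' x := by
    have h0 : 0 ≤ ⨆ p : Admissible R, p.1 x := Real.iSup_nonneg fun p => p.1.nonneg x
    apply le_antisymm
    · refine ciSup_le fun p => ?_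
      rw [p.1.star_mul_self]
      exact pow_le_pow_left₀ (p.1.nonneg x) (le_ciSup (bddAbove_seminorms R x) p) 2
    · refine (Real.le_sqrt h0 (Real.iSup_nonneg fun p => p.1.nonneg _)).1 (ciSup_le fun p => ?_)
      refine Real.le_sqrt_of_sq_le ?_
      rw [← p.1.star_mul_self]
      exact le_ciSup (bddAbove_seminorms R (star x * x)) p

end FreeSphere

/-- The universal unital `C*`-algebra generated by `z₁, …, z_N` subject to the relations
`∑ zᵢ zᵢ* = 1 = ∑ zᵢ* zᵢ` and `r = 0` for `r ∈ R`: the completion of `ℂ⟨zᵢ, zᵢ*⟩` with respect to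
the biggest `C*`-seminorm compatible with these relations. -/
abbrev SphereCStar {N : ℕ} (R : Set (StarPoly N)) : Type := (FreeSphere.maxSeminorm R).Compl

/-- The monomial `z_{i₁} ⋯ z_{i_K}`. -/
def StarPoly.zProd {N K : ℕ} (i : Fin K → Fin N) : StarPoly N :=
  (List.ofFn fun k => StarPoly.z (i k)).prod

/-- The monomial `z_{i₁}* ⋯ z_{i_K}*`. -/
def StarPoly.zStarProd {N K : ℕ} (i : Fin K → Fin N) : StarPoly N :=
  (List.ofFn fun k => star (StarPoly.z (i k))).prod

/-- The relators `[z_{i₁} ⋯ z_{i_K}, z_{j₁} ⋯ z_{j_K}]` and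
`[z_{i₁} ⋯ z_{i_K}, z_{j₁}* ⋯ z_{j_K}*]`, for all multi-indices `i`, `j` of length `K`. -/
def halfLiberatedRelators (N K : ℕ) : Set (StarPoly N) :=
  {r | ∃ i j : Fin K → Fin N, r = ⁅StarPoly.zProd i, StarPoly.zProd j⁆} ∪
    {r | ∃ i j : Fin K → Fin N, r = ⁅StarPoly.zProd i, StarPoly.zStarProd j⁆}

/-- The `C*`-algebra `C(S^{N-1}_{ℂ,K})` of the `K`-half-liberated complex sphere. -/
abbrev HalfLiberatedSphere (N K : ℕ) : Type := SphereCStar (halfLiberatedRelators N K)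

/-! ### Irreducible representations -/

/-- A representation of a `C*`-algebra `A` on a Hilbert space `H` is irreducible if `H ≠ 0` and
the only closed subspaces invariant under `A` are `0` and `H`. -/
def IsIrreducibleRep {A H : Type*} [CStarAlgebra A] [NormedAddCommGroup H]
    [InnerProductSpace ℂ H] [CompleteSpace H] (π : A →⋆ₐ[ℂ] (H →L[ℂ] H)) : Prop :=
  Nontrivial H ∧ ∀ W : Submodule ℂ H, IsClosed (W : Set H) →
    (∀ a : A, ∀ v ∈ W, π a v ∈ W) → W = ⊥ ∨ W = ⊤

end

/-!
Let `B` be the `*`-algebra generated by the words of length `K` in the letters `zᵢ`. It is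
commutative by the defining relations, and inserting `1 = ∑ w w*`, the sum over the words `w` of
length `K - 1`, between `zᵢ` and `zⱼ*` shows that it contains `zᵢ zⱼ*` and `zᵢ* zⱼ`. It follows that
`σ b = ∑ zₖ b zₖ*` is an automorphism of `B` with `σ b * zᵢ = zᵢ * b` and `σ ^ K = 1`.

In an irreducible representation the `σ`-invariant elements commute with all letters, so they are
scalars by Schur's lemma. Hence `B` is integral over `ℂ` and finitely generated, so it acts with a
joint eigenvector `v`. A letter sends a joint eigenvector to another one, the image line does not
depend on the letter, and after `K` steps one is back on the line of `v`: the `K` lines met on the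
way span a reducing subspace, which has to be everything.

The bound `K` is attained by weighted cyclic shifts on `ℂ^K`, two of them being nonzero. All their
words of length `K` are diagonal, and they act irreducibly if the weights of one of them are nonzero
and of distinct moduli.
-/

/-! ### Half-liberated families -/

section Word

variable {ι E F : Type*}

/-- The word `Z_{f 0} ⋯ Z_{f (n - 1)}` in the letters `Z i`, for a multi-index `f`. -/
def word [Monoid E] (Z : ι → E) {n : ℕ} (f : Fin n → ι) : E := (List.ofFn fun k => Z (f k)).prod

section Monoid

variable [Monoid E] (Z : ι → E) {n : ℕ}

lemma word_cons (i : ι) (f : Fin n → ι) :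
    word Z (Fin.cons i f : Fin (n + 1) → ι) = Z i * word Z f := by
  simp [word]

lemma word_snoc (f : Fin n → ι) (i : ι) :
    word Z (Fin.snoc f i : Fin (n + 1) → ι) = word Z f * Z i := by
  simp only [word, List.ofFn_succ', Fin.snoc_castSucc, Fin.snoc_last, List.concat_eq_append,
    List.prod_append, List.prod_singleton]

lemma star_word [StarMul E] (f : Fin n → ι) : star (word Z f) = word (star Z) (f ∘ Fin.rev) := by
  induction n with
  | zero => simp [word]
  | succ n ih =>
    cases f using Fin.consCases with | cons i f => ?_
    have hrev : (Fin.cons i f : Fin (n + 1) → ι) ∘ Fin.rev = Fin.snoc (f ∘ Fin.rev) i := by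
      ext k; simp [Fin.cons_rev]
    rw [word_cons, star_mul, ih, hrev, word_snoc, Pi.star_apply]

lemma map_word [Monoid F] {G : Type*} [FunLike G E F] [MonoidHomClass G E F] (φ : G)
    (f : Fin n → ι) : φ (word Z f) = word (φ ∘ Z) f := by
  simp [word, map_list_prod, List.map_ofFn, Function.comp_def]

end Monoid

lemma sum_word_mul_star_word [Fintype ι] [Ring E] [StarRing E] {Z : ι → E}
    (h : ∑ i, Z i * star (Z i) = 1) (n : ℕ) :
    ∑ f : Fin n → ι, word Z f * star (word Z f) = 1 := by
  induction n with
  | zero => simp [word]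
  | succ n ih =>
    rw [← (Fin.consEquiv fun _ => ι).sum_comp, Fintype.sum_prod_type]
    calc ∑ i, ∑ f : Fin n → ι, word Z (Fin.cons i f : Fin (n + 1) → ι) *
          star (word Z (Fin.cons i f : Fin (n + 1) → ι))
        = ∑ i, Z i * (∑ f : Fin n → ι, word Z f * star (word Z f)) * star (Z i) := by
          simp only [word_cons, star_mul, Finset.mul_sum, Finset.sum_mul, mul_assoc]
      _ = 1 := by simp only [ih, mul_one, h]

end Word

/-- A finite family `Z` in a `*`-ring which satisfies the defining relations of the coordinates of
the `K`-half-liberated complex sphere. -/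
structure IsHalfLiberated {ι E : Type*} [Fintype ι] [Ring E] [StarRing E] (K : ℕ) (Z : ι → E) :
    Prop where
  sum_mul_star : ∑ i, Z i * star (Z i) = 1
  sum_star_mul : ∑ i, star (Z i) * Z i = 1
  commute (f g : Fin K → ι) : Commute (word Z f) (word Z g)
  commute_star (f g : Fin K → ι) : Commute (word Z f) (word (star Z) g)

namespace IsHalfLiberated

variable {ι E F : Type*} [Fintype ι] [Ring E] [StarRing E] {K : ℕ} {Z : ι → E}

protected lemma star (h : IsHalfLiberated K Z) : IsHalfLiberated K (star Z) where
  sum_mul_star := by simpa using h.sum_star_mul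
  sum_star_mul := by simpa using h.sum_mul_star
  commute f g := by
    have := (h.commute (f ∘ Fin.rev) (g ∘ Fin.rev)).star_star
    simpa only [star_word, Function.comp_assoc, Fin.rev_involutive.comp_self,
      Function.comp_id] using this
  commute_star f g := by simpa only [star_star] using (h.commute_star g f).symm

lemma map [Ring F] [StarRing F] [Algebra ℂ E] [Algebra ℂ F] (h : IsHalfLiberated K Z)
    (φ : E →⋆ₐ[ℂ] F) : IsHalfLiberated K (φ ∘ Z) where
  sum_mul_star := by simpa [map_star] using congrArg φ h.sum_mul_star
  sum_star_mul := by simpa [map_star] using congrArg φ h.sum_star_mul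
  commute f g := by simpa only [map_word] using (h.commute f g).map φ
  commute_star f g := by
    have hstar : star (φ ∘ Z) = φ ∘ star Z := funext fun i => (map_star φ (Z i)).symm
    simpa only [map_word, hstar] using (h.commute_star f g).map φ

end IsHalfLiberated

section WordAlgebra

variable {ι E : Type*} [Ring E] [StarRing E] [Algebra ℂ E] [StarModule ℂ E] (K : ℕ) (Z : ι → E)

/-- The `*`-algebra generated by the words of length `K` in the letters `Z i`; for a half-liberated
family it is commutative. -/
def wordAlgebra : StarSubalgebra ℂ E :=
  StarAlgebra.adjoin ℂ (Set.range (word Z : (Fin K → ι) → E))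

variable {K}

lemma word_mem_wordAlgebra (f : Fin K → ι) : word Z f ∈ wordAlgebra K Z :=
  StarAlgebra.subset_adjoin ℂ _ ⟨f, rfl⟩

lemma wordAlgebra_star_le : wordAlgebra K (star Z) ≤ wordAlgebra K Z := by
  refine StarAlgebra.adjoin_le ?_
  rintro _ ⟨f, rfl⟩
  have hf : word (star Z) f = star (word Z (f ∘ Fin.rev)) := by
    rw [star_word, Function.comp_assoc, Fin.rev_involutive.comp_self, Function.comp_id]
  exact hf ▸ star_mem (word_mem_wordAlgebra Z _)

lemma wordAlgebra_star : wordAlgebra K (star Z) = wordAlgebra K Z :=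
  le_antisymm (wordAlgebra_star_le Z)
    (by simpa only [star_star] using wordAlgebra_star_le (K := K) (star Z))

lemma fg_wordAlgebra [Finite ι] : (wordAlgebra K Z).toSubalgebra.FG := by
  rw [wordAlgebra, StarAlgebra.adjoin_toSubalgebra]
  have hfin : (Set.range (word Z : (Fin K → ι) → E)).Finite := Set.finite_range _
  exact Subalgebra.fg_def.2 ⟨_, hfin.union hfin.star, rfl⟩

end WordAlgebra

/-- The map `x ↦ ∑ k, Z k * x * (Z k)*`. On the word algebra of a half-liberated family it is an
automorphism which intertwines the letters. -/
def sumConj {ι E : Type*} [Fintype ι] [Ring E] [StarRing E] (Z : ι → E) (x : E) : E :=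
  ∑ k, Z k * x * star (Z k)

namespace IsHalfLiberated

variable {ι E : Type*} [Fintype ι] [Ring E] [StarRing E] [Algebra ℂ E] {K : ℕ} {Z : ι → E}

lemma sumConj_algebraMap (h : IsHalfLiberated K Z) (c : ℂ) :
    sumConj Z (algebraMap ℂ E c) = algebraMap ℂ E c := by
  simp only [sumConj, ← Algebra.commutes c, mul_assoc, ← Finset.mul_sum, h.sum_mul_star, mul_one]

variable [StarModule ℂ E]

lemma isMulCommutative_wordAlgebra (h : IsHalfLiberated K Z) :
    IsMulCommutative (wordAlgebra K Z) := by
  refine StarAlgebra.isMulCommutative_adjoin ℂ ?_ ?_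
  · rintro _ ⟨f, rfl⟩ _ ⟨g, rfl⟩
    exact h.commute f g
  · rintro _ ⟨f, rfl⟩ _ ⟨g, rfl⟩
    rw [star_word]
    exact h.commute_star f _

lemma commute_of_mem (h : IsHalfLiberated K Z) {b c : E} (hb : b ∈ wordAlgebra K Z)
    (hc : c ∈ wordAlgebra K Z) : Commute b c :=
  congrArg Subtype.val (h.isMulCommutative_wordAlgebra.is_comm.comm ⟨b, hb⟩ ⟨c, hc⟩)

variable [NeZero K]

lemma mul_star_mem (h : IsHalfLiberated K Z) (i j : ι) :
    Z i * star (Z j) ∈ wordAlgebra K Z := by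
  obtain ⟨n, rfl⟩ := Nat.exists_eq_succ_of_ne_zero (NeZero.ne K)
  have hsum : Z i * star (Z j) = ∑ f : Fin n → ι, word Z (Fin.cons i f : Fin (n + 1) → ι) *
      star (word Z (Fin.cons j f : Fin (n + 1) → ι)) := by
    simp only [word_cons, star_mul]
    calc Z i * star (Z j)
        = Z i * (∑ f : Fin n → ι, word Z f * star (word Z f)) * star (Z j) := by
          rw [sum_word_mul_star_word h.sum_mul_star, mul_one]
      _ = _ := by simp only [Finset.mul_sum, Finset.sum_mul, mul_assoc]
  rw [hsum]
  exact sum_mem fun f _ => mul_mem (word_mem_wordAlgebra Z _) (star_mem (word_mem_wordAlgebra Z _))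

lemma star_mul_mem (h : IsHalfLiberated K Z) (i j : ι) :
    star (Z i) * Z j ∈ wordAlgebra K Z := by
  simpa [wordAlgebra_star] using h.star.mul_star_mem i j

lemma sumConj_mul (h : IsHalfLiberated K Z) {b : E} (hb : b ∈ wordAlgebra K Z) (i : ι) :
    sumConj Z b * Z i = Z i * b :=
  calc sumConj Z b * Z i = ∑ k, Z k * (b * (star (Z k) * Z i)) := by
        simp only [sumConj, Finset.sum_mul, mul_assoc]
    _ = ∑ k, Z k * star (Z k) * (Z i * b) :=
        Finset.sum_congr rfl fun k _ => by
          rw [(h.commute_of_mem hb (h.star_mul_mem k i)).eq, mul_assoc, mul_assoc]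
    _ = Z i * b := by rw [← Finset.sum_mul, h.sum_mul_star, one_mul]

lemma sumConj_mul_sumConj (h : IsHalfLiberated K Z) {b : E} (hb : b ∈ wordAlgebra K Z) (c : E) :
    sumConj Z b * sumConj Z c = sumConj Z (b * c) := by
  simp only [sumConj.eq_1 Z c, sumConj.eq_1 Z (b * c), Finset.mul_sum, ← mul_assoc,
    h.sumConj_mul hb]

lemma sumConj_word_mem (h : IsHalfLiberated K Z) (f : Fin K → ι) :
    sumConj Z (word Z f) ∈ wordAlgebra K Z := by
  obtain ⟨n, rfl⟩ := Nat.exists_eq_succ_of_ne_zero (NeZero.ne K)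
  cases f using Fin.snocCases with | snoc f i => ?_
  refine sum_mem fun k _ => ?_
  have hregroup : Z k * word Z (Fin.snoc f i : Fin (n + 1) → ι) * star (Z k) =
      word Z (Fin.cons k f : Fin (n + 1) → ι) * (Z i * star (Z k)) := by
    simp only [word_snoc, word_cons, mul_assoc]
  rw [hregroup]
  exact mul_mem (word_mem_wordAlgebra Z _) (h.mul_star_mem i k)

lemma sumConj_mem (h : IsHalfLiberated K Z) {b : E} (hb : b ∈ wordAlgebra K Z) :
    sumConj Z b ∈ wordAlgebra K Z := by
  refine StarAlgebra.adjoin_induction (p := fun b _ => sumConj Z b ∈ wordAlgebra K Z)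
    ?_ ?_ ?_ ?_ ?_ hb
  · rintro _ ⟨f, rfl⟩
    exact h.sumConj_word_mem f
  · intro c
    rw [h.sumConj_algebraMap]
    exact algebraMap_mem _ c
  · intro b c _ _ hb hc
    simpa only [sumConj, mul_add, add_mul, Finset.sum_add_distrib] using add_mem hb hc
  · intro b c hb _ hb' hc'
    rw [← h.sumConj_mul_sumConj hb]
    exact mul_mem hb' hc'
  · intro b _ hb
    simpa only [sumConj, star_sum, star_mul, star_star, mul_assoc] using star_mem hb

lemma sumConj_star_sumConj (h : IsHalfLiberated K Z) {b : E} (hb : b ∈ wordAlgebra K Z) :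
    sumConj (star Z) (sumConj Z b) = b := by
  simp only [sumConj.eq_1 (star Z), Pi.star_apply, star_star, mul_assoc, h.sumConj_mul hb]
  simp only [← mul_assoc, ← Finset.sum_mul, h.sum_star_mul, one_mul]

/-- The automorphism `b ↦ ∑ k, Z k * b * (Z k)*` of the word algebra. -/
noncomputable def wordAut (h : IsHalfLiberated K Z) : wordAlgebra K Z ≃ₐ[ℂ] wordAlgebra K Z where
  toFun b := ⟨sumConj Z b, h.sumConj_mem b.2⟩
  invFun b := ⟨sumConj (star Z) b, by
    simpa only [wordAlgebra_star] using h.star.sumConj_mem ((wordAlgebra_star Z).symm ▸ b.2)⟩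
  left_inv b := Subtype.ext (h.sumConj_star_sumConj b.2)
  right_inv b := Subtype.ext <| by
    simpa only [star_star] using h.star.sumConj_star_sumConj ((wordAlgebra_star Z).symm ▸ b.2)
  map_mul' b c := Subtype.ext (h.sumConj_mul_sumConj b.2 c).symm
  map_add' b c := Subtype.ext <| by
    simp [sumConj, mul_add, add_mul, Finset.sum_add_distrib]
  commutes' c := Subtype.ext (h.sumConj_algebraMap c)

lemma wordAut_mul (h : IsHalfLiberated K Z) (b : wordAlgebra K Z) (i : ι) :
    (h.wordAut b : E) * Z i = Z i * b :=
  h.sumConj_mul b.2 i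

lemma mul_eq_mul_wordAut_symm (h : IsHalfLiberated K Z) (b : wordAlgebra K Z) (i : ι) :
    (b : E) * Z i = Z i * (h.wordAut.symm b : E) := by
  simpa using h.wordAut_mul (h.wordAut.symm b) i

lemma wordAut_symm_mul_star (h : IsHalfLiberated K Z) (b : wordAlgebra K Z) (i : ι) :
    (h.wordAut.symm b : E) * star (Z i) = star (Z i) * b :=
  h.star.sumConj_mul ((wordAlgebra_star Z).symm ▸ b.2) i

lemma wordAut_pow_mul_word (h : IsHalfLiberated K Z) (b : wordAlgebra K Z) {n : ℕ}
    (f : Fin n → ι) : ((h.wordAut ^ n) b : E) * word Z f = word Z f * b := by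
  induction n generalizing b with
  | zero => simp [word]
  | succ n ih =>
    cases f using Fin.consCases with | cons i f => ?_
    rw [word_cons, pow_succ', AlgEquiv.mul_apply, ← mul_assoc, h.wordAut_mul, mul_assoc, ih,
      mul_assoc]

lemma wordAut_pow_eq_one (h : IsHalfLiberated K Z) : h.wordAut ^ K = 1 := by
  ext b
  have hword (f : Fin K → ι) : ((h.wordAut ^ K) b : E) * word Z f = b * word Z f := by
    rw [h.wordAut_pow_mul_word, (h.commute_of_mem b.2 (word_mem_wordAlgebra Z f)).eq]
  rw [AlgEquiv.one_apply, ← mul_one ((h.wordAut ^ K) b : E), ← mul_one (b : E),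
    ← sum_word_mul_star_word h.sum_mul_star K]
  simp only [Finset.mul_sum, ← mul_assoc, hword]

lemma commute_of_wordAut_eq (h : IsHalfLiberated K Z) {b : wordAlgebra K Z}
    (hb : h.wordAut b = b) (i : ι) : Commute (b : E) (Z i) ∧ Commute (b : E) (star (Z i)) := by
  have hb' : h.wordAut.symm b = b := h.wordAut.symm_apply_eq.2 hb.symm
  exact ⟨(congrArg (fun c : wordAlgebra K Z => (c : E) * Z i) hb).symm.trans (h.wordAut_mul b i),
    (congrArg (fun c : wordAlgebra K Z => (c : E) * star (Z i)) hb').symm.trans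
      (h.wordAut_symm_mul_star b i)⟩

end IsHalfLiberated

/-! ### Irreducible families of operators -/

lemma exists_cfc_mul_cfc_eq_zero {A : Type*} [CStarAlgebra A] {a : A} [IsStarNormal a] {x y : ℂ}
    (hx : x ∈ spectrum ℂ a) (hy : y ∈ spectrum ℂ a) (hxy : x ≠ y) :
    ∃ f g : ℂ → ℂ, cfc f a ≠ 0 ∧ cfc g a ≠ 0 ∧ cfc f a * cfc g a = 0 := by
  let bump (w z : ℂ) : ℂ := (max 0 (dist x y / 2 - dist z w) : ℝ)
  have hcont (w : ℂ) : Continuous (bump w) :=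
    Complex.continuous_ofReal.comp <|
      continuous_const.max (continuous_const.sub (continuous_id.dist continuous_const))
  have hbump (w : ℂ) (hw : w ∈ spectrum ℂ a) : cfc (bump w) a ≠ 0 := by
    rw [← cfc_zero ℂ a, Ne, cfc_eq_cfc_iff_eqOn (hf := (hcont w).continuousOn)]
    intro h
    have hpos : 0 < dist x y := dist_pos.2 hxy
    have := h hw
    simp only [bump, dist_self, sub_zero, Pi.zero_apply, Complex.ofReal_eq_zero,
      max_eq_left_iff] at this
    linarith
  refine ⟨bump x, bump y, hbump x hx, hbump y hy, ?_⟩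
  rw [← cfc_mul _ _ a (hcont x).continuousOn (hcont y).continuousOn, ← cfc_zero ℂ a]
  refine cfc_congr fun z _ => ?_
  have htri := dist_triangle_left x y z
  rcases le_total (dist x y / 2) (dist z x) with h | h
  · simp [bump, max_eq_left (sub_nonpos.2 h)]
  · have h' : dist x y / 2 ≤ dist z y := by linarith
    simp [bump, max_eq_left (sub_nonpos.2 h')]

section Irreducible

variable {ι H : Type*} [NormedAddCommGroup H] [InnerProductSpace ℂ H] [CompleteSpace H]

/-- A family of operators is irreducible if no closed subspace other than `0` and `H` is invariant
under the family and its adjoints. -/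
def IsIrreducibleFamily (Z : ι → H →L[ℂ] H) : Prop :=
  ∀ W : Submodule ℂ H, IsClosed (W : Set H) →
    (∀ i, ∀ v ∈ W, Z i v ∈ W ∧ star (Z i) v ∈ W) → W = ⊥ ∨ W = ⊤

namespace IsIrreducibleFamily

variable {Z : ι → H →L[ℂ] H}

lemma eq_zero_or_eq_zero_of_mul_eq_zero (hZ : IsIrreducibleFamily Z) {S T : H →L[ℂ] H}
    (hS : ∀ i, Commute S (Z i) ∧ Commute S (star (Z i))) (hST : S * T = 0) : S = 0 ∨ T = 0 := by
  have hker {R : H →L[ℂ] H} (hR : Commute S R) {v : H} (hv : v ∈ S.ker) : R v ∈ S.ker := by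
    have hcomm : S (R v) = R (S v) := DFunLike.congr_fun hR.eq v
    rw [LinearMap.mem_ker] at hv ⊢
    exact hcomm.trans ((congrArg R hv).trans (map_zero R))
  rcases hZ S.ker S.isClosed_ker fun i v hv => ⟨hker (hS i).1 hv, hker (hS i).2 hv⟩ with h | h
  · right
    ext v
    have hTv : T v ∈ S.ker := DFunLike.congr_fun hST v
    rwa [h] at hTv
  · left
    ext v
    exact LinearMap.mem_ker.1 (h ▸ Submodule.mem_top : v ∈ S.ker)

lemma exists_eq_algebraMap (hZ : IsIrreducibleFamily Z) {T : H →L[ℂ] H} [IsStarNormal T]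
    (hT : ∀ i, Commute T (Z i) ∧ Commute T (star (Z i))) : ∃ c : ℂ, T = algebraMap ℂ _ c := by
  have hsub : (spectrum ℂ T).Subsingleton := by
    by_contra hne
    obtain ⟨x, hx, y, hy, hxy⟩ := Set.not_subsingleton_iff.1 hne
    obtain ⟨f, g, hf, hg, hfg⟩ := exists_cfc_mul_cfc_eq_zero hx hy hxy
    have hT' (i : ι) : Commute (star T) (Z i) ∧ Commute (star T) (star (Z i)) :=
      ⟨by simpa using (hT i).2.star_star, (hT i).1.star_star⟩
    have hcomm (i : ι) : Commute (cfc f T) (Z i) ∧ Commute (cfc f T) (star (Z i)) :=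
      ⟨(hT i).1.cfc (hT' i).1 f, (hT i).2.cfc (hT' i).2 f⟩
    exact (hZ.eq_zero_or_eq_zero_of_mul_eq_zero hcomm hfg).elim hf hg
  obtain h | ⟨c, h⟩ := hsub.eq_empty_or_singleton
  · exact ⟨0, CFC.eq_algebraMap_of_spectrum_subset_singleton T 0 (by simp [h])⟩
  · exact ⟨c, CFC.eq_algebraMap_of_spectrum_subset_singleton T c h.le⟩

lemma finrank_le_card (hZ : IsIrreducibleFamily Z) {κ : Type*} [Fintype κ] {w : κ → H} {k₀ : κ}
    (hw : w k₀ ≠ 0)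
    (hspan : ∀ i k, Z i (w k) ∈ Submodule.span ℂ (Set.range w) ∧
      star (Z i) (w k) ∈ Submodule.span ℂ (Set.range w)) :
    FiniteDimensional ℂ H ∧ Module.finrank ℂ H ≤ Fintype.card κ := by
  set W := Submodule.span ℂ (Set.range w)
  have hfin : FiniteDimensional ℂ W := FiniteDimensional.span_of_finite ℂ (Set.finite_range w)
  have hinv {T : H →L[ℂ] H} (hT : ∀ k, T (w k) ∈ W) : ∀ v ∈ W, T v ∈ W := by
    suffices W ≤ W.comap (T : H →ₗ[ℂ] H) from fun v hv => this hv
    exact Submodule.span_le.2 (Set.range_subset_iff.2 hT)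
  have htop : W = ⊤ := by
    refine (hZ W W.closed_of_finiteDimensional fun i v hv =>
      ⟨hinv (fun k => (hspan i k).1) v hv, hinv (fun k => (hspan i k).2) v hv⟩).resolve_left ?_
    exact fun hbot => hw ((Submodule.span_eq_bot.1 hbot) _ ⟨k₀, rfl⟩)
  have hcard : Module.finrank ℂ W ≤ Fintype.card κ := finrank_range_le_card w
  rw [htop] at hfin hcard
  exact ⟨Module.finite_def.2 (Module.Finite.iff_fg.1 hfin), finrank_top ℂ H ▸ hcard⟩

/-- The lines through the `η n` are permuted cyclically, up to annihilation, by the family and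
backwards by the adjoints, so the first `K` of them span a reducing subspace. -/
lemma finrank_le_of_periodic_chain (hZ : IsIrreducibleFamily Z) {K : ℕ} [NeZero K] {η : ℕ → H}
    (hη : η 0 ≠ 0) (hup : ∀ n i, Z i (η n) ∈ ℂ ∙ η (n + 1))
    (hdown : ∀ n i, star (Z i) (η (n + 1)) ∈ ℂ ∙ η n) (hper : ℂ ∙ η K = ℂ ∙ η 0) :
    FiniteDimensional ℂ H ∧ Module.finrank ℂ H ≤ K := by
  set W := Submodule.span ℂ (Set.range fun k : Fin K => η k)
  have hlt {n : ℕ} (hn : n < K) : ℂ ∙ η n ≤ W := by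
    rw [Submodule.span_singleton_le_iff_mem]
    exact Submodule.subset_span ⟨⟨n, hn⟩, rfl⟩
  have hle {n : ℕ} (hn : n ≤ K) : ℂ ∙ η n ≤ W := by
    obtain hn | rfl := hn.lt_or_eq
    · exact hlt hn
    · exact hper ▸ hlt (NeZero.pos _)
  have hstar (i : ι) (k : ℕ) (hk : k < K) : star (Z i) (η k) ∈ W := by
    rcases k with _ | n
    · obtain ⟨n, rfl⟩ := Nat.exists_eq_succ_of_ne_zero (NeZero.ne K)
      have hmem : η 0 ∈ ℂ ∙ η (n + 1) := hper ▸ Submodule.mem_span_singleton_self _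
      obtain ⟨c, hc⟩ := Submodule.mem_span_singleton.1 hmem
      rw [← hc, map_smul]
      exact W.smul_mem c (hlt n.lt_succ_self (hdown n i))
    · exact hle (by omega) (hdown n i)
  simpa using hZ.finrank_le_card (w := fun k : Fin K => η k) (k₀ := ⟨0, NeZero.pos K⟩) hη
    fun i k => ⟨hle k.2 (hup k i), hstar i k k.2⟩

end IsIrreducibleFamily

lemma apply_mem_of_mem_adjoin {Z : ι → H →L[ℂ] H} {W : Submodule ℂ H}
    (hW : ∀ i, ∀ v ∈ W, Z i v ∈ W ∧ star (Z i) v ∈ W) {T : H →L[ℂ] H}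
    (hT : T ∈ StarAlgebra.adjoin ℂ (Set.range Z)) : ∀ v ∈ W, T v ∈ W ∧ star T v ∈ W := by
  induction hT using StarAlgebra.adjoin_induction with
  | mem T hT =>
    obtain ⟨i, rfl⟩ := hT
    exact hW i
  | algebraMap c =>
    rw [← algebraMap_star_comm]
    exact fun v hv => ⟨W.smul_mem c hv, W.smul_mem (star c) hv⟩
  | add S T _ _ hS hT =>
    rw [star_add]
    exact fun v hv => ⟨W.add_mem (hS v hv).1 (hT v hv).1, W.add_mem (hS v hv).2 (hT v hv).2⟩
  | mul S T _ _ hS hT =>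
    rw [star_mul]
    exact fun v hv => ⟨(hS _ (hT v hv).1).1, (hT _ (hS v hv).2).2⟩
  | star T _ hT =>
    rw [star_star]
    exact fun v hv => (hT v hv).symm

open scoped CStarAlgebra in
lemma isIrreducibleRep_iff {A : Type*} [CStarAlgebra A] {x : ι → A}
    (hx : (StarAlgebra.adjoin ℂ (Set.range x)).topologicalClosure = ⊤)
    (π : A →⋆ₐ[ℂ] (H →L[ℂ] H)) :
    IsIrreducibleRep π ↔ Nontrivial H ∧ IsIrreducibleFamily (π ∘ x) := by
  refine and_congr_right fun _ => forall_congr' fun W => imp_congr_right fun hW =>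
    imp_congr ⟨fun h i v hv => ⟨h _ v hv, map_star π (x i) ▸ h _ v hv⟩, fun h a v hv => ?_⟩ Iff.rfl
  have hadjoin {b : A} (hb : b ∈ StarAlgebra.adjoin ℂ (Set.range x)) : π b v ∈ W := by
    have hπb : π b ∈ StarAlgebra.adjoin ℂ (Set.range (π ∘ x)) := by
      rw [Set.range_comp, ← StarAlgHom.map_adjoin]
      exact StarSubalgebra.mem_map.2 ⟨b, hb, rfl⟩
    exact (apply_mem_of_mem_adjoin h hπb v hv).1
  have hcont : Continuous fun b => π b v :=
    (ContinuousLinearMap.apply ℂ H v).continuous.comp (map_continuous π)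
  have ha : a ∈ (StarAlgebra.adjoin ℂ (Set.range x)).topologicalClosure := hx ▸ trivial
  exact closure_minimal (fun b => hadjoin) (hW.preimage hcont) ha

end Irreducible
/-! ### Irreducible half-liberated families -/

lemma exists_ne_zero_forall_smul_eq_smul (k : Type*) {R M : Type*} [Field k] [IsAlgClosed k]
    [CommRing R] [IsNoetherianRing R] [Algebra k R] [Algebra.IsIntegral k R] [AddCommGroup M]
    [Module R M] [Module k M] [IsScalarTower k R M] [Nontrivial M] :
    ∃ v : M, v ≠ 0 ∧ ∀ b : R, ∃ c : k, b • v = c • v := by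
  obtain ⟨p, hp⟩ := associatedPrimes.nonempty R M
  obtain ⟨hprime, v, rfl⟩ := isAssociatedPrime_iff.1 hp
  refine ⟨v, fun hv => hprime.ne_top ?_, fun b => ?_⟩
  · simp [hv, Ideal.eq_top_iff_one, Submodule.mem_colon_singleton]
  · obtain ⟨c, hc⟩ := (IsAlgClosed.algebraMap_bijective_of_isIntegral (k := k)).2
      (Ideal.Quotient.mk ((⊥ : Submodule R M).colon {v}) b)
    have hmem : b - algebraMap k R c ∈ (⊥ : Submodule R M).colon {v} := Ideal.Quotient.eq.1 hc.symm
    rw [Submodule.mem_colon_singleton, Submodule.mem_bot, sub_smul, algebraMap_smul,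
      sub_eq_zero] at hmem
    exact ⟨c, hmem⟩

namespace IsHalfLiberated

variable {ι H : Type*} [Fintype ι] [NormedAddCommGroup H] [InnerProductSpace ℂ H] [CompleteSpace H]
  {K : ℕ} [NeZero K] {Z : ι → H →L[ℂ] H}

open scoped IsMulCommutative in
lemma isIntegral_wordAlgebra (h : IsHalfLiberated K Z) (hZ : IsIrreducibleFamily Z) :
    Algebra.IsIntegral ℂ (wordAlgebra K Z) := by
  have := h.isMulCommutative_wordAlgebra
  have hfin : Finite (Subgroup.zpowers h.wordAut) :=
    (isOfFinOrder_iff_pow_eq_one.2 ⟨K, NeZero.pos K, h.wordAut_pow_eq_one⟩).finite_zpowers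
  have hinv : Algebra.IsInvariant ℂ (wordAlgebra K Z) (Subgroup.zpowers h.wordAut) := by
    refine ⟨fun b hb => ?_⟩
    have hfix : h.wordAut b = b := hb ⟨h.wordAut, Subgroup.mem_zpowers _⟩
    have hnormal : IsStarNormal (b : H →L[ℂ] H) := ⟨h.commute_of_mem (star_mem b.2) b.2⟩
    obtain ⟨c, hc⟩ := hZ.exists_eq_algebraMap (h.commute_of_wordAut_eq hfix)
    exact ⟨c, Subtype.ext hc.symm⟩
  exact Algebra.IsInvariant.isIntegral ℂ _ (Subgroup.zpowers h.wordAut)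

end IsHalfLiberated

/-- A nonzero joint eigenvector of the word algebra. -/
def IsWordEigenvector {ι H : Type*} [NormedAddCommGroup H] [InnerProductSpace ℂ H] [CompleteSpace H]
    (K : ℕ) (Z : ι → H →L[ℂ] H) (v : H) : Prop :=
  v ≠ 0 ∧ ∀ b ∈ wordAlgebra K Z, b v ∈ ℂ ∙ v

lemma IsWordEigenvector.span_singleton_chain {ι H : Type*} [NormedAddCommGroup H]
    [InnerProductSpace ℂ H] [CompleteSpace H] {K : ℕ} {Z : ι → H →L[ℂ] H} {v : H}
    (hv : IsWordEigenvector K Z v) {η : ℕ → H} {m : ℕ → ι} (h0 : η 0 = v)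
    (hsucc : ∀ n, η (n + 1) = Z (m n) (η n)) (hK : η K ≠ 0) : ℂ ∙ η K = ℂ ∙ v := by
  have hword (n : ℕ) : ∃ f : Fin n → ι, η n = word Z f v := by
    induction n with
    | zero => exact ⟨![], by simp [word, h0]⟩
    | succ n ih =>
      obtain ⟨f, hf⟩ := ih
      exact ⟨Fin.cons (m n) f, by rw [word_cons, mul_apply_eq_comp, hsucc, hf]⟩
  obtain ⟨f, hf⟩ := hword K
  obtain ⟨c, hc⟩ := Submodule.mem_span_singleton.1 (hv.2 _ (word_mem_wordAlgebra Z f))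
  rw [← hf] at hc
  have hc0 : c ≠ 0 := by
    rintro rfl
    exact hK (by rw [← hc, zero_smul])
  rw [← hc, Submodule.span_singleton_smul_eq hc0.isUnit]

namespace IsHalfLiberated

variable {ι H : Type*} [Fintype ι] [NormedAddCommGroup H] [InnerProductSpace ℂ H] [CompleteSpace H]
  {K : ℕ} [NeZero K] {Z : ι → H →L[ℂ] H}

open scoped IsMulCommutative in
lemma exists_isWordEigenvector (h : IsHalfLiberated K Z) (hZ : IsIrreducibleFamily Z)
    [Nontrivial H] : ∃ v, IsWordEigenvector K Z v := by
  have := h.isMulCommutative_wordAlgebra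
  have := h.isIntegral_wordAlgebra hZ
  have : Algebra.FiniteType ℂ (wordAlgebra K Z) :=
    (wordAlgebra K Z).toSubalgebra.fg_iff_finiteType.1 (fg_wordAlgebra Z)
  have := Algebra.FiniteType.isNoetherianRing ℂ (wordAlgebra K Z)
  have : IsScalarTower ℂ (wordAlgebra K Z) H := ⟨fun _ _ _ => rfl⟩
  obtain ⟨v, hv, heig⟩ := exists_ne_zero_forall_smul_eq_smul ℂ (R := wordAlgebra K Z) (M := H)
  refine ⟨v, hv, fun b hb => Submodule.mem_span_singleton.2 ?_⟩
  obtain ⟨c, hc⟩ := heig ⟨b, hb⟩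
  exact ⟨c, hc.symm⟩

lemma isWordEigenvector_apply (h : IsHalfLiberated K Z) {v : H} (hv : IsWordEigenvector K Z v)
    {m : ι} (hm : Z m v ≠ 0) : IsWordEigenvector K Z (Z m v) := by
  refine ⟨hm, fun b hb => ?_⟩
  let b' : wordAlgebra K Z := h.wordAut.symm ⟨b, hb⟩
  have hcomm : b (Z m v) = Z m ((b' : H →L[ℂ] H) v) :=
    DFunLike.congr_fun (h.mul_eq_mul_wordAut_symm ⟨b, hb⟩ m) v
  obtain ⟨c, hc⟩ := Submodule.mem_span_singleton.1 (hv.2 b' b'.2)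
  rw [hcomm, ← hc, map_smul]
  exact Submodule.smul_mem _ c (Submodule.mem_span_singleton_self _)

lemma exists_successor (h : IsHalfLiberated K Z) {v : H} (hv : IsWordEigenvector K Z v) :
    ∃ m, IsWordEigenvector K Z (Z m v) ∧ (∀ i, Z i v ∈ ℂ ∙ Z m v) ∧
      ∀ i, star (Z i) (Z m v) ∈ ℂ ∙ v := by
  obtain ⟨m, hm⟩ : ∃ m, Z m v ≠ 0 := by
    by_contra! hall
    have hsum : (∑ i, star (Z i) * Z i) v = 0 := by simp [hall]
    rw [h.sum_star_mul] at hsum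
    exact hv.1 hsum
  have hm' := h.isWordEigenvector_apply hv hm
  have hdown (i : ι) : star (Z i) (Z m v) ∈ ℂ ∙ v := hv.2 _ (h.star_mul_mem i m)
  refine ⟨m, hm', fun i => ?_, hdown⟩
  obtain ⟨c, hc⟩ := Submodule.mem_span_singleton.1 (hdown m)
  have hc0 : c ≠ 0 := by
    rintro rfl
    refine hm ((inner_self_eq_zero (𝕜 := ℂ)).1 ?_)
    rw [← ContinuousLinearMap.adjoint_inner_right, ← ContinuousLinearMap.star_eq_adjoint, ← hc,
      zero_smul, inner_zero_right]
  have hmem : (Z i * star (Z m)) (Z m v) ∈ ℂ ∙ Z m v := hm'.2 _ (h.mul_star_mem i m)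
  have hsmul : (Z i * star (Z m)) (Z m v) = c • Z i v :=
    (congrArg (Z i) hc.symm).trans (map_smul (Z i) c v)
  rwa [hsmul, Submodule.smul_mem_iff _ hc0] at hmem

lemma exists_chain (h : IsHalfLiberated K Z) {v : H} (hv : IsWordEigenvector K Z v) :
    ∃ (η : ℕ → H) (m : ℕ → ι), η 0 = v ∧ (∀ n, η (n + 1) = Z (m n) (η n)) ∧ (∀ n, η n ≠ 0) ∧
      (∀ n i, Z i (η n) ∈ ℂ ∙ η (n + 1)) ∧ ∀ n i, star (Z i) (η (n + 1)) ∈ ℂ ∙ η n := by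
  choose m hm hup hdown using fun w : {w : H // IsWordEigenvector K Z w} => h.exists_successor w.2
  obtain ⟨η, hη, hsucc⟩ : ∃ η : ℕ → {w : H // IsWordEigenvector K Z w},
      η 0 = ⟨v, hv⟩ ∧ ∀ n, η (n + 1) = ⟨Z (m (η n)) (η n), hm (η n)⟩ :=
    ⟨fun n => (fun w => ⟨Z (m w) w, hm w⟩)^[n] ⟨v, hv⟩, rfl,
      fun n => Function.iterate_succ_apply' _ n _⟩
  have hsucc' (n : ℕ) : (η (n + 1) : H) = Z (m (η n)) (η n) := congrArg Subtype.val (hsucc n)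
  exact ⟨fun n => η n, fun n => m (η n), congrArg Subtype.val hη, hsucc', fun n => (η n).2.1,
    fun n i => by simpa only [hsucc'] using hup (η n) i,
    fun n i => by simpa only [hsucc'] using hdown (η n) i⟩

theorem finrank_le (h : IsHalfLiberated K Z) (hZ : IsIrreducibleFamily Z) [Nontrivial H] :
    FiniteDimensional ℂ H ∧ Module.finrank ℂ H ≤ K := by
  obtain ⟨v, hv⟩ := h.exists_isWordEigenvector hZ
  obtain ⟨η, m, hη, hsucc, hne, hup, hdown⟩ := h.exists_chain hv
  exact hZ.finrank_le_of_periodic_chain (hne 0) hup hdown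
    (hη ▸ hv.span_singleton_chain hη hsucc (hne K))

end IsHalfLiberated

/-! ### The universal property -/

namespace StarPoly

variable {N : ℕ}

lemma monomial_of_mul (x : Fin N × Bool) (w : StarWord N) :
    (monomial (FreeMonoid.of x * w) 1 : StarPoly N) =
      monomial (FreeMonoid.of x) 1 * monomial w 1 := by
  rw [monomial_mul, one_mul]

lemma adjoin_z : StarAlgebra.adjoin ℂ (Set.range (z : Fin N → StarPoly N)) = ⊤ := by
  have hz (i : Fin N) : z i ∈ StarAlgebra.adjoin ℂ (Set.range (z : Fin N → StarPoly N)) :=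
    StarAlgebra.subset_adjoin ℂ _ ⟨i, rfl⟩
  suffices ∀ f : StarPoly N, f ∈ StarAlgebra.adjoin ℂ (Set.range z) from
    eq_top_iff.2 fun f _ => this f
  intro f
  induction f using induction_monomial with
  | zero => exact zero_mem _
  | add f g hf hg => exact add_mem hf hg
  | mono w c =>
    rw [← mul_one c, ← smul_monomial]
    refine SMulMemClass.smul_mem c ?_
    induction w using FreeMonoid.inductionOn' with
    | one => exact one_mem _
    | of_mul x w ih =>
      rw [monomial_of_mul]
      refine mul_mem ?_ ih
      obtain ⟨i, _ | _⟩ := x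
      · exact star_z i ▸ star_mem (hz i)
      · exact hz i

variable {E : Type*} [Ring E] [StarRing E]

/-- The value of the letters `zᵢ` and `zᵢ*` when `Z i` is substituted for `zᵢ`. -/
def letterEval (Z : Fin N → E) (x : Fin N × Bool) : E := if x.2 then Z x.1 else star (Z x.1)

lemma lift_letterEval_adj (Z : Fin N → E) (w : StarWord N) :
    FreeMonoid.lift (letterEval Z) w.adj = star (FreeMonoid.lift (letterEval Z) w) := by
  induction w using FreeMonoid.inductionOn' with
  | one => simp [StarWord.adj]
  | of_mul x w ih =>
    have hx : StarWord.adj (FreeMonoid.of x) = FreeMonoid.of (x.1, !x.2) := rfl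
    rw [StarWord.adj_mul, map_mul, map_mul, star_mul, ih, hx, FreeMonoid.lift_eval_of,
      FreeMonoid.lift_eval_of]
    obtain ⟨i, _ | _⟩ := x <;> simp [letterEval]

variable [Algebra ℂ E]

/-- Evaluation of `*`-polynomials at a family, as a morphism of algebras. -/
noncomputable def evalAlgHom (Z : Fin N → E) : StarPoly N →ₐ[ℂ] E :=
  MonoidAlgebra.lift ℂ E (StarWord N) (FreeMonoid.lift (letterEval Z))

lemma evalAlgHom_monomial (Z : Fin N → E) (w : StarWord N) (c : ℂ) :
    evalAlgHom Z (monomial w c) = c • FreeMonoid.lift (letterEval Z) w :=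
  MonoidAlgebra.lift_single ..

lemma evalAlgHom_star [StarModule ℂ E] (Z : Fin N → E) (f : StarPoly N) :
    evalAlgHom Z (star f) = star (evalAlgHom Z f) := by
  induction f using induction_monomial with
  | zero => simp only [star_zero, map_zero]
  | add f g hf hg => simp only [star_add, map_add, hf, hg]
  | mono w c =>
    calc evalAlgHom Z (star (monomial w c))
        = evalAlgHom Z (monomial w.adj (star c)) := congrArg _ (adj_monomial w c)
      _ = star (evalAlgHom Z (monomial w c)) := by
        rw [evalAlgHom_monomial, evalAlgHom_monomial, lift_letterEval_adj, star_smul]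

/-- Evaluation of `*`-polynomials at a family, as a morphism of `*`-algebras. -/
noncomputable def eval [StarModule ℂ E] (Z : Fin N → E) : StarPoly N →⋆ₐ[ℂ] E :=
  { evalAlgHom Z with map_star' := evalAlgHom_star Z }

lemma eval_z [StarModule ℂ E] (Z : Fin N → E) (i : Fin N) : eval Z (z i) = Z i := by
  change evalAlgHom Z (monomial (FreeMonoid.of (i, true)) 1) = Z i
  simp [evalAlgHom_monomial, letterEval]

end StarPoly

namespace CStarSeminorm.Compl

open UniformSpace

variable {P E : Type*} [Ring P] [StarRing P] [Algebra ℂ P] {p : CStarSeminorm P}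
  [CStarAlgebra E] (φ : P →⋆ₐ[ℂ] E) (hφ : ∀ x, ‖φ x‖ ≤ p x)

/-- The continuous extension to the completion of a morphism bounded by the seminorm, as a morphism
of rings. -/
noncomputable def liftRingHom : p.Compl →+* E :=
  Completion.extensionHom (α := p.Pre) (φ : P →+* E)
    (AddMonoidHomClass.continuous_of_bound (𝓕 := p.Pre →+* E) _ 1 fun x =>
      (hφ x).trans_eq (one_mul _).symm)

lemma liftRingHom_of (x : P) : liftRingHom φ hφ (of p x) = φ x :=
  Completion.extensionHom_coe (α := p.Pre) _ _ _

lemma continuous_liftRingHom : Continuous (liftRingHom φ hφ) :=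
  Completion.continuous_extension

lemma liftRingHom_star (x : p.Compl) :
    liftRingHom φ hφ (star x) = star (liftRingHom φ hφ x) := by
  have hcont := continuous_liftRingHom φ hφ
  induction x using induction_of with
  | hc => exact isClosed_eq (hcont.comp (continuous_star p)) hcont.star
  | h x => rw [star_of, liftRingHom_of, liftRingHom_of, StarHomClass.map_star]

/-- The continuous extension to the completion of a morphism bounded by the seminorm. -/
noncomputable def lift [StarModule ℂ P] : p.Compl →⋆ₐ[ℂ] E :=
  { liftRingHom φ hφ with
    commutes' c := by
      rw [← AlgHomClass.commutes φ c, ← AlgHomClass.commutes (ofHom p) c]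
      exact liftRingHom_of φ hφ _
    map_star' := liftRingHom_star φ hφ }

lemma lift_ofHom [StarModule ℂ P] (x : P) : lift φ hφ (ofHom p x) = φ x := liftRingHom_of φ hφ x

end CStarSeminorm.Compl

namespace FreeSphere

variable {N : ℕ} {R : Set (StarPoly N)} {E : Type*} [CStarAlgebra E]

/-- The `C*`-seminorm `x ↦ ‖φ x‖` of a morphism `φ` which vanishes on the relators. -/
noncomputable def pullbackSeminorm (φ : StarPoly N →⋆ₐ[ℂ] E)
    (hφ : ∀ r ∈ sphereRelators N ∪ R, φ r = 0) : Admissible R :=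
  ⟨{ toSeminorm := (normSeminorm ℂ E).comp (φ : StarPoly N →ₐ[ℂ] E).toLinearMap
     mul_le' x y := (congrArg norm (map_mul φ x y)).trans_le (norm_mul_le _ _)
     star_mul_self' x := by
      change ‖φ (star x * x)‖ = ‖φ x‖ ^ 2
      rw [map_mul, map_star, CStarRing.norm_star_mul_self, sq] },
    fun r hr => (congrArg norm (hφ r hr)).trans norm_zero⟩

lemma norm_le_maxSeminorm (φ : StarPoly N →⋆ₐ[ℂ] E)
    (hφ : ∀ r ∈ sphereRelators N ∪ R, φ r = 0) (x : StarPoly N) : ‖φ x‖ ≤ maxSeminorm R x :=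
  le_ciSup (bddAbove_seminorms R x) (pullbackSeminorm φ hφ)

lemma maxSeminorm_eq_zero {r : StarPoly N} (hr : r ∈ sphereRelators N ∪ R) :
    maxSeminorm R r = 0 :=
  (iSup_congr fun p : Admissible R => p.2 r hr).trans ciSup_const

end FreeSphere

namespace HalfLiberatedSphere

open FreeSphere StarPoly CStarSeminorm

variable {N K : ℕ}

lemma isHalfLiberated_comp_z_iff {E : Type*} [Ring E] [StarRing E] [Algebra ℂ E]
    (φ : StarPoly N →⋆ₐ[ℂ] E) :
    IsHalfLiberated K (φ ∘ z) ↔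
      ∀ r ∈ sphereRelators N ∪ halfLiberatedRelators N K, φ r = 0 := by
  have hword (f : Fin K → Fin N) : φ (zProd f) = word (φ ∘ z) f := map_word z φ f
  have hstar (f : Fin K → Fin N) : φ (zStarProd f) = word (star (φ ∘ z)) f := by
    have : star (φ ∘ z) = φ ∘ star z := funext fun i => (map_star φ (z i)).symm
    exact this ▸ map_word (star z) φ f
  have hlie (x y : StarPoly N) : φ ⁅x, y⁆ = 0 ↔ Commute (φ x) (φ y) := by
    rw [Ring.lie_def, map_sub, map_mul, map_mul, sub_eq_zero, commute_iff_eq]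
  constructor
  · rintro ⟨h₁, h₂, h₃, h₄⟩ r ((rfl | rfl) | ⟨f, g, rfl⟩ | ⟨f, g, rfl⟩)
    · simpa [sub_eq_zero, map_star φ] using h₁
    · simpa [sub_eq_zero, map_star φ] using h₂
    · exact (hlie _ _).2 (by simpa only [hword] using h₃ f g)
    · exact (hlie _ _).2 (by simpa only [hword, hstar] using h₄ f g)
  · intro h
    refine ⟨?_, ?_, fun f g => ?_, fun f g => ?_⟩
    · simpa [sub_eq_zero, map_star φ] using h _ (Or.inl (Or.inl rfl))
    · simpa [sub_eq_zero, map_star φ] using h _ (Or.inl (Or.inr rfl))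
    · simpa only [hword] using (hlie _ _).1 (h _ (Or.inr (Or.inl ⟨f, g, rfl⟩)))
    · simpa only [hword, hstar] using (hlie _ _).1 (h _ (Or.inr (Or.inr ⟨f, g, rfl⟩)))

/-- The coordinates, i.e. the generators of the algebra of the half-liberated sphere. -/
noncomputable def coord (i : Fin N) : HalfLiberatedSphere N K := Compl.ofHom _ (z i)

lemma isHalfLiberated_coord : IsHalfLiberated K (coord : Fin N → HalfLiberatedSphere N K) :=
  (isHalfLiberated_comp_z_iff (Compl.ofHom _)).2 fun r hr => by
    rw [← norm_eq_zero]
    exact (Compl.norm_of _ r).trans (maxSeminorm_eq_zero hr)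

lemma exists_starAlgHom_coord_eq {E : Type*} [CStarAlgebra E] {Z : Fin N → E}
    (h : IsHalfLiberated K Z) :
    ∃ φ : HalfLiberatedSphere N K →⋆ₐ[ℂ] E, ∀ i, φ (coord i) = Z i := by
  have hcomp : eval Z ∘ z = Z := funext (eval_z Z)
  refine ⟨Compl.lift (eval Z) <| norm_le_maxSeminorm _ <|
    (isHalfLiberated_comp_z_iff (eval Z)).1 (hcomp.symm ▸ h), fun i => ?_⟩
  rw [coord, Compl.lift_ofHom, eval_z]

lemma topologicalClosure_adjoin_coord :
    (StarAlgebra.adjoin ℂ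
      (Set.range (coord : Fin N → HalfLiberatedSphere N K))).topologicalClosure = ⊤ := by
  have hrange : StarAlgebra.adjoin ℂ (Set.range (coord : Fin N → HalfLiberatedSphere N K)) =
      (Compl.ofHom (maxSeminorm (halfLiberatedRelators N K))).range := by
    rw [StarAlgHom.range_eq_map_top, ← adjoin_z, StarAlgHom.map_adjoin, ← Set.range_comp]
    rfl
  refine eq_top_iff.2 fun a _ => ?_
  rw [hrange]
  exact Compl.denseRange_of (maxSeminorm (halfLiberatedRelators N K)) a

end HalfLiberatedSphere

/-! ### Weighted shifts -/

open Matrix in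
lemma sum_diagonal_eq_one {ι κ R : Type*} [Fintype ι] [DecidableEq κ] [Semiring R]
    {a : ι → κ → R} (h : ∀ k, ∑ i, a i k = 1) : ∑ i, diagonal (a i) = 1 := by
  ext k l
  rcases eq_or_ne k l with rfl | hkl
  · simp [Matrix.sum_apply, h]
  · simp [Matrix.sum_apply, hkl]

section Shift

open Matrix

variable {G R : Type*} [AddCommGroup G] [DecidableEq G]

/-- The weighted shift `eₖ ↦ aₖ eₖ₊ₘ` on the space with basis `eₖ`, `k ∈ G`. -/
def shift [Zero R] (m : G) (a : G → R) : Matrix G G R := of fun k l => if k = l + m then a l else 0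

lemma shift_zero [Zero R] (a : G → R) : shift 0 a = diagonal a := by
  ext k l
  rcases eq_or_ne k l with rfl | h <;> simp [shift, *]

lemma star_shift [AddMonoid R] [StarAddMonoid R] (m : G) (a : G → R) :
    star (shift m a) = shift (-m) fun k => star (a (k - m)) := by
  ext k l
  by_cases h : l = k + m
  · simp [shift, star_apply, h]
  · simp [shift, star_apply, h, ← sub_eq_add_neg, eq_sub_iff_add_eq, eq_comm]

variable [Fintype G]

lemma shift_mul_shift [NonUnitalNonAssocSemiring R] (m n : G) (a b : G → R) :
    shift m a * shift n b = shift (m + n) fun k => a (k + n) * b k := by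
  ext k l
  rw [mul_apply, Fintype.sum_eq_single (l + n) fun j hj => by simp [shift, hj]]
  simp [shift, add_right_comm, ← add_assoc]

lemma exists_word_shift_eq [Semiring R] {ι : Type*} (m : G) (a : ι → G → R) {n : ℕ}
    (f : Fin n → ι) : ∃ b, word (fun i => shift m (a i)) f = shift (n • m) b := by
  induction n with
  | zero => exact ⟨1, by simp [word, shift_zero]⟩
  | succ n ih =>
    cases f using Fin.consCases with | cons i f => ?_
    obtain ⟨b, hb⟩ := ih f
    exact ⟨_, by rw [word_cons, hb, shift_mul_shift, succ_nsmul']⟩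

variable [CommRing R] [StarRing R]

lemma star_shift_mul_shift (m : G) (a : G → R) :
    star (shift m a) * shift m a = diagonal fun k => star (a k) * a k := by
  simp [star_shift, shift_mul_shift, shift_zero]

lemma shift_mul_star_shift (m : G) (a : G → R) :
    shift m a * star (shift m a) = diagonal fun k => star (a (k - m)) * a (k - m) := by
  simp [star_shift, shift_mul_shift, shift_zero, ← sub_eq_add_neg, mul_comm]

lemma isHalfLiberated_shift {ι : Type*} [Fintype ι] {K : ℕ} {m : G} (hm : K • m = 0)
    {a : ι → G → R} (ha : ∀ k, ∑ i, star (a i k) * a i k = 1) :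
    IsHalfLiberated K fun i => shift m (a i) := by
  have hdiag {m : G} (hm : K • m = 0) (a : ι → G → R) (f : Fin K → ι) :
      ∃ b, word (fun i => shift m (a i)) f = diagonal b := by
    simpa only [hm, shift_zero] using exists_word_shift_eq m a f
  have hcomm (b c : G → R) : Commute (diagonal b) (diagonal c) :=
    (Commute.all b c).map (diagonalRingHom G R)
  have hstar : star (fun i => shift m (a i)) = fun i => shift (-m) fun k => star (a i (k - m)) :=
    funext fun i => star_shift m (a i)
  refine ⟨?_, ?_, fun f g => ?_, fun f g => ?_⟩
  · simp only [shift_mul_star_shift]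
    exact sum_diagonal_eq_one fun k => ha (k - m)
  · simp only [star_shift_mul_shift]
    exact sum_diagonal_eq_one ha
  · obtain ⟨b, hb⟩ := hdiag hm a f
    obtain ⟨c, hc⟩ := hdiag hm a g
    rw [hb, hc]
    exact hcomm b c
  · obtain ⟨b, hb⟩ := hdiag hm a f
    have hm' : K • -m = 0 := by rw [smul_neg, hm, neg_zero]
    obtain ⟨c, hc⟩ := hdiag hm' (fun i k => star (a i (k - m))) g
    rw [hb, hstar, hc]
    exact hcomm b c

end Shift

section IrreducibleShift

open Matrix

lemma exists_single_mem_of_injective {κ : Type*} [Fintype κ] [DecidableEq κ] {d : κ → ℂ}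
    (hd : Function.Injective d) {W : Submodule ℂ (EuclideanSpace ℂ κ)}
    (hW : ∀ v ∈ W, toEuclideanCLM (𝕜 := ℂ) (diagonal d) v ∈ W) (hne : W ≠ ⊥) :
    ∃ k, EuclideanSpace.single k (1 : ℂ) ∈ W := by
  have := Submodule.nontrivial_iff_ne_bot.2 hne
  obtain ⟨μ, hμ⟩ := Module.End.exists_eigenvalue
    ((toEuclideanCLM (𝕜 := ℂ) (diagonal d) : _ →ₗ[ℂ] EuclideanSpace ℂ κ).restrict hW)
  obtain ⟨⟨w, hw⟩, heig⟩ := hμ.exists_hasEigenvector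
  have hval (l : κ) : d l * w l = μ * w l := by
    have := congrArg (fun v : W => (v : EuclideanSpace ℂ κ) l) heig.apply_eq_smul
    simpa [mulVec_diagonal] using this
  obtain ⟨k, hk⟩ : ∃ k, w k ≠ 0 := by
    by_contra! h
    exact heig.2 (Subtype.ext (PiLp.ext h))
  have hzero (l : κ) (hl : l ≠ k) : w l = 0 := by
    by_contra hwl
    exact hl (hd ((mul_right_cancel₀ hwl (hval l)).trans (mul_right_cancel₀ hk (hval k)).symm))
  have hsingle : EuclideanSpace.single k (1 : ℂ) = (w k)⁻¹ • w := by
    ext l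
    rcases eq_or_ne l k with rfl | hl
    · simp [hk]
    · simp [hl, hzero l hl]
  exact ⟨k, hsingle ▸ W.smul_mem _ hw⟩

variable {G : Type*} [AddCommGroup G] [DecidableEq G] [Fintype G]

lemma toEuclideanCLM_shift_single (m : G) (a : G → ℂ) (k : G) :
    toEuclideanCLM (𝕜 := ℂ) (shift m a) (EuclideanSpace.single k 1) =
      a k • EuclideanSpace.single (k + m) (1 : ℂ) := by
  ext l
  simp [shift, mulVec_single]

lemma isIrreducibleFamily_shift {ι : Type*} {m : G} (hm : ∀ k, k ∈ AddSubmonoid.multiples m)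
    {a : ι → G → ℂ} {i : ι} (ha : ∀ k, a i k ≠ 0)
    (hinj : Function.Injective fun k => star (a i k) * a i k) :
    IsIrreducibleFamily fun i => toEuclideanCLM (𝕜 := ℂ) (shift m (a i)) := by
  refine fun W _ hW => or_iff_not_imp_left.2 fun hne => ?_
  have hdiag (v) (hv : v ∈ W) :
      toEuclideanCLM (𝕜 := ℂ) (diagonal fun k => star (a i k) * a i k) v ∈ W := by
    rw [← star_shift_mul_shift m, map_mul, map_star]
    exact (hW i _ (hW i v hv).1).2
  obtain ⟨k, hk⟩ := exists_single_mem_of_injective hinj hdiag hne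
  have hall (l : G) : EuclideanSpace.single l (1 : ℂ) ∈ W := by
    obtain ⟨n, hn⟩ := hm (l - k)
    obtain rfl : k + n • m = l := by rw [show n • m = l - k from hn, add_sub_cancel]
    clear hn
    induction n with
    | zero => simpa using hk
    | succ n ih =>
      have hmem := (hW i _ ih).1
      rw [toEuclideanCLM_shift_single, W.smul_mem_iff (ha _)] at hmem
      rwa [succ_nsmul, ← add_assoc]
  rw [eq_top_iff, ← (EuclideanSpace.basisFun G ℂ).toBasis.span_eq, Submodule.span_le]
  rintro _ ⟨l, rfl⟩
  simpa using hall l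

end IrreducibleShift

lemma exists_weights {ι κ : Type*} [Fintype ι] [Nontrivial ι] {t : κ → ℝ} (h₀ : ∀ k, 0 ≤ t k)
    (h₁ : ∀ k, t k ≤ 1) :
    ∃ (a : ι → κ → ℂ) (i : ι), (∀ k, star (a i k) * a i k = t k) ∧
      ∀ k, ∑ i, star (a i k) * a i k = 1 := by
  classical
  have hsqrt {x : ℝ} (hx : 0 ≤ x) : star ((√x : ℝ) : ℂ) * (√x : ℝ) = x := by
    rw [Complex.star_def, Complex.conj_ofReal, ← Complex.ofReal_mul, Real.mul_self_sqrt hx]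
  obtain ⟨i, j, hij⟩ := exists_pair_ne ι
  let a (l : ι) (k : κ) : ℂ := if l = i then (√(t k) : ℝ) else if l = j then (√(1 - t k) : ℝ) else 0
  have hi (k : κ) : star (a i k) * a i k = t k := by simpa only [a, if_true] using hsqrt (h₀ k)
  have hj (k : κ) : star (a j k) * a j k = (1 - t k : ℝ) := by
    simpa only [a, if_neg hij.symm, if_true] using hsqrt (sub_nonneg.2 (h₁ k))
  refine ⟨a, i, hi, fun k => ?_⟩
  rw [Fintype.sum_eq_add i j hij fun l hl => by simp [a, hl.1, hl.2], hi, hj]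
  simp

namespace HalfLiberatedSphere

open CStarSeminorm

variable {N K : ℕ} [NeZero K]

theorem finrank_le_of_isIrreducibleRep {H : Type*} [NormedAddCommGroup H] [InnerProductSpace ℂ H]
    [CompleteSpace H] {π : HalfLiberatedSphere N K →⋆ₐ[ℂ] (H →L[ℂ] H)} (hπ : IsIrreducibleRep π) :
    FiniteDimensional ℂ H ∧ Module.finrank ℂ H ≤ K := by
  obtain ⟨_, hirr⟩ := (isIrreducibleRep_iff topologicalClosure_adjoin_coord π).1 hπ
  exact (isHalfLiberated_coord.map π).finrank_le hirr

theorem exists_isIrreducibleRep (hN : 2 ≤ N) :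
    ∃ π : HalfLiberatedSphere N K →⋆ₐ[ℂ]
      (EuclideanSpace ℂ (Fin K) →L[ℂ] EuclideanSpace ℂ (Fin K)), IsIrreducibleRep π := by
  have : Nontrivial (Fin N) := Fin.nontrivial_iff_two_le.2 hN
  obtain ⟨a, i, hai, hsum⟩ := exists_weights (ι := Fin N) (t := fun k : Fin K => ((k : ℝ) + 1)⁻¹)
    (fun k => by positivity) (fun k => inv_le_one_of_one_le₀ (by simp))
  have hne (k : Fin K) : a i k ≠ 0 := by
    intro h
    have := hai k
    rw [h, mul_zero, eq_comm, Complex.ofReal_eq_zero] at this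
    exact (by positivity : ((k : ℝ) + 1)⁻¹ ≠ 0) this
  have hinj : Function.Injective fun k => star (a i k) * a i k := by
    intro k l hkl
    simp only [hai, Complex.ofReal_inj, inv_inj, add_left_inj, Nat.cast_inj] at hkl
    exact Fin.ext hkl
  have hone (k : Fin K) : k ∈ AddSubmonoid.multiples (1 : Fin K) :=
    ⟨k, by open Fin.CommRing in simp⟩
  have hshift : IsHalfLiberated K fun i => shift (1 : Fin K) (a i) :=
    isHalfLiberated_shift (by simpa using card_nsmul_eq_zero' (x := (1 : Fin K))) hsum
  obtain ⟨π, hπ⟩ := exists_starAlgHom_coord_eq (hshift.map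
    (Matrix.toEuclideanCLM (n := Fin K) (𝕜 := ℂ) :
      Matrix (Fin K) (Fin K) ℂ →⋆ₐ[ℂ] EuclideanSpace ℂ (Fin K) →L[ℂ] EuclideanSpace ℂ (Fin K)))
  refine ⟨π, (isIrreducibleRep_iff topologicalClosure_adjoin_coord π).2 ⟨inferInstance, ?_⟩⟩
  rw [show π ∘ coord = _ from funext hπ]
  exact isIrreducibleFamily_shift hone hne hinj

theorem le_of_starAlgEquiv {K' : ℕ} [NeZero K'] (hN : 2 ≤ N)
    (f : HalfLiberatedSphere N K ≃⋆ₐ[ℂ] HalfLiberatedSphere N K') : K' ≤ K := by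
  obtain ⟨π, hπ⟩ := exists_isIrreducibleRep (K := K') hN
  have hirr : IsIrreducibleRep (π.comp (f : HalfLiberatedSphere N K →⋆ₐ[ℂ] _)) := by
    refine ⟨hπ.1, fun W hW hinv => hπ.2 W hW fun a v hv => ?_⟩
    obtain ⟨b, rfl⟩ := f.surjective a
    exact hinv b v hv
  simpa using (finrank_le_of_isIrreducibleRep hirr).2

end HalfLiberatedSphere

theorem corollary5p5 (N : ℕ) (hN : 2 ≤ N) :
    (∀ K : ℕ, 1 ≤ K →
      (∃ π : HalfLiberatedSphere N K →⋆ₐ[ℂ]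
          (EuclideanSpace ℂ (Fin K) →L[ℂ] EuclideanSpace ℂ (Fin K)), IsIrreducibleRep π) ∧
      (∀ (H : Type*) [NormedAddCommGroup H] [InnerProductSpace ℂ H] [CompleteSpace H]
          (π : HalfLiberatedSphere N K →⋆ₐ[ℂ] (H →L[ℂ] H)), IsIrreducibleRep π →
          FiniteDimensional ℂ H ∧ Module.finrank ℂ H ≤ K)) ∧
    (∀ K K' : ℕ, 1 ≤ K → 1 ≤ K' → K ≠ K' →
      IsEmpty (HalfLiberatedSphere N K ≃⋆ₐ[ℂ] HalfLiberatedSphere N K')) := by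
  have neZero {K : ℕ} (hK : 1 ≤ K) : NeZero K := ⟨by omega⟩
  refine ⟨fun K hK => ?_, fun K K' hK hK' hne => ⟨fun f => ?_⟩⟩
  · have := neZero hK
    exact ⟨HalfLiberatedSphere.exists_isIrreducibleRep hN,
      fun H _ _ _ π => HalfLiberatedSphere.finrank_le_of_isIrreducibleRep⟩
  · have := neZero hK
    have := neZero hK'
    exact hne (le_antisymm (HalfLiberatedSphere.le_of_starAlgEquiv hN f.symm)
      (HalfLiberatedSphere.le_of_starAlgEquiv hN f))
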